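/- Let $\mathbb K=\mathbb R$ or $\mathbb C$, let $(\Omega,\mathcal A,\mu)$ be a probability space and $T:\Omega\to\Omega$ a measurable $\mu$-preserving map that is mixing, i.e. $\mu(A\cap T^{-n}B)\to\mu(A)\mu(B)$ for all $A,B\in\mathcal A$. The transfer operator $\widehat T$ on $L^1(\mu)$ is determined by $\int \widehat Tf\cdot g\,d\mu=\int f\cdot g\circ T\,d\mu$ for all $f\in L^1$, $g\in L^\infty$. Let $\mathcal F$ be a Banach algebra, with norm $\|\cdot\|$, of ($\mu$-a.e. classes of) measurable functions $\Omega\to\mathbb K$ under pointwise operations, which contains the constants and satisfies $\|f\|\ge |f|_\infty$ for all $f\in\mathcal F$. Assume that $\widehat T$ maps $\mathcal F$ into $\mathcal F$, is bounded with respect to $\|\cdot\|$, and has a spectral gap on $\mathcal F$: $\widehat T|_{\mathcal F}=\lambda P+Q$ with $\lambda\in\mathbb K$ and bounded linear operators $P,Q$ on $\mathcal F$ such that $P^2=P$, $\dim \operatorname{Im}P=1$, $PQ=QP=0$, and the spectral radius $\rho(Q)=\lim_m\|Q^m\|^{1/m}$ satisfies $\rho(Q)<|\lambda|$. Let $\chi:\Omega\to[0,\infty)$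 be measurable and suppose there are $K_1,K_2>0$ such that for every $\ell>0$ the functions $\chi\cdot\mathbb 1_{\{\chi\le \ell\}}$ and $\mathbb 1_{\{\chi>\ell\}}$ belong to $\mathcal F$, with $\|\chi\cdot\mathbb 1_{\{\chi\le \ell\}}\|\le K_1\ell$ and $\|\mathbb 1_{\{\chi>\ell\}}\|\le K_2$. Let $\Psi$ be the set of all $\psi:\{1,2,\dots\}\to(0,\infty)$ with $\sum_{n\ge1}1/\psi(n)<\infty$, and for $0<\epsilon<1/4$, $\psi\in\Psi$, $n\ge 3$ and $k\ge0$ set $$c_{\epsilon,\psi}(k,n)=\bigl(\max\{k,\log\psi(\lfloor\log n\rfloor)\}\bigr)^{1/2+\epsilon}\cdot\bigl(\log\psi(\lfloor\log n\rfloor)\bigr)^{1/2-\epsilon},$$ which is well defined for all sufficiently large $n$ since $\psi(m)\to\infty$. Then there exist constants $N\in\mathbb N$ and $V>0$, depending only on the system and $\chi$, such that for all $0<\epsilon<1/4$, all $\psi\in\Psi$ and all sequences $(u_n)_{n\ge1}$ of positive reals, with $p_n=\mu(\chi>u_n)$ and $\mathsf S_n\mathbb 1_{\{\chi>u_n\}}=\sum_{k=1}^n\mathbb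 1_{\{\chi>u_n\}}\circ T^{k-1}$, $$\mu\Bigl(\bigl|\mathsf S_n\mathbb 1_{\{\chi>u_n\}}-p_n n\bigr|\ge V\cdot c_{\epsilon,\psi}(p_n n,n)\ \text{ for infinitely many } n>N\Bigr)=0 .$$ -/

import Mathlib

open MeasureTheory Filter Topology
open scoped ENNReal

noncomputable section

namespace TrimmedSums

section Operators

variable {𝕜 : Type*} [RCLike 𝕜] {F : Type*} [NormedAddCommGroup F] [NormedSpace 𝕜 F]

/-- The spectral radius `lim ‖Aⁿ‖ ^ (1 / n)` of a bounded operator on a real or complex Banach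
space. For complex scalars it is the supremum of the moduli of the points of the spectrum, see
`opSpectralRadius_eq`; for real scalars it is the spectral radius of the complexified operator. -/
def opSpectralRadius (A : F →L[𝕜] F) : ℝ≥0∞ :=
  limsup (fun n : ℕ => (‖A ^ n‖₊ : ℝ≥0∞) ^ (1 / n : ℝ)) atTop

/-- `U = c P + N` with `P` a projection onto a line, `P N = N P = 0` and `ρ(N) < |c|`. -/
def HasSpectralGap (U : F →L[𝕜] F) : Prop :=
  ∃ (c : 𝕜) (P N : F →L[𝕜] F),
    U = c • P + N ∧
    P * P = P ∧ Module.finrank 𝕜 (LinearMap.range (P : F →ₗ[𝕜] F)) = 1 ∧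
    P * N = 0 ∧ N * P = 0 ∧
    opSpectralRadius N < ENNReal.ofReal ‖c‖

end Operators

theorem opSpectralRadius_eq {F : Type*} [NormedAddCommGroup F] [NormedSpace ℂ F]
    [CompleteSpace F] (A : F →L[ℂ] F) : opSpectralRadius A = spectralRadius ℂ A :=
  (spectrum.pow_nnnorm_pow_one_div_tendsto_nhds_spectralRadius A).limsup_eq

section Systems

variable {𝕜 : Type*} [RCLike 𝕜] {Ω : Type*} [MeasurableSpace Ω]

/-- `T` preserves `μ` and `μ (A ∩ T⁻ⁿ B) → μ A * μ B` for all measurable `A`, `B`. -/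
def IsMixing (T : Ω → Ω) (μ : Measure Ω) : Prop :=
  MeasurePreserving T μ μ ∧
    ∀ A B : Set Ω, MeasurableSet A → MeasurableSet B →
      Tendsto (fun n : ℕ => μ (A ∩ T^[n] ⁻¹' B)) atTop (𝓝 (μ A * μ B))

/-- `h` is (a version of) the image of `f ∈ L¹` under the transfer operator of `T`, that is
`∫ h g dμ = ∫ f (g ∘ T) dμ` for all `g ∈ L^∞`; this determines `h` up to null sets, see
`IsTransferImage.ae_eq`. -/
def IsTransferImage (T : Ω → Ω) (μ : Measure Ω) (f h : Ω → 𝕜) : Prop :=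
  Integrable f μ ∧ Integrable h μ ∧
    ∀ g : Ω → 𝕜, MemLp g ∞ μ → ∫ ω, h ω * g ω ∂μ = ∫ ω, f ω * g (T ω) ∂μ

theorem IsTransferImage.ae_eq {T : Ω → Ω} {μ : Measure Ω} {f h h' : Ω → 𝕜}
    (H : IsTransferImage T μ f h) (H' : IsTransferImage T μ f h') : h =ᵐ[μ] h' := by
  refine Integrable.ae_eq_of_forall_setIntegral_eq h h' H.2.1 H'.2.1 fun s hs _ => ?_
  have hm : MemLp (s.indicator (fun _ => (1 : 𝕜))) ∞ μ :=
    (memLp_top_const (1 : 𝕜)).indicator hs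
  have key := (H.2.2 _ hm).trans (H'.2.2 _ hm).symm
  have e : ∀ k : Ω → 𝕜, (fun ω => k ω * s.indicator (fun _ => (1 : 𝕜)) ω) = s.indicator k := by
    intro k
    ext ω
    by_cases hω : ω ∈ s <;> simp [hω]
  rw [e, e, integral_indicator hs, integral_indicator hs] at key
  exact key

variable {μ : Measure Ω} {F : Type*} [NormedCommRing F] [NormedAlgebra 𝕜 F]

/-- The spectral gap setting for `(Ω, 𝒜, T, μ, F, ‖·‖)`. The Banach algebra `F` of (classes
modulo `μ` of) measurable functions is given as a commutative unital Banach algebra together with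
its inclusion `ι`, an injective unital algebra homomorphism; as `ι` maps `1` to `1`, the algebra
contains the constants. -/
structure PropertyC (T : Ω → Ω) (ι : F →ₗ[𝕜] (Ω →ₘ[μ] 𝕜)) : Prop where
  isProbabilityMeasure : IsProbabilityMeasure μ
  mixing : IsMixing T μ
  complete : CompleteSpace F
  injective : Function.Injective ι
  map_one : ι 1 = 1
  map_mul : ∀ f g : F, ι (f * g) = ι f * ι g
  /-- `|f|_∞ ≤ ‖f‖` -/
  ae_norm_le : ∀ f : F, ∀ᵐ ω ∂μ, ‖ι f ω‖ ≤ ‖f‖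
  /-- The transfer operator restricts to a bounded operator on `F` with a spectral gap. -/
  transfer : ∃ U : F →L[𝕜] F,
    (∀ f : F, IsTransferImage T μ (ι f) (ι (U f))) ∧ HasSpectralGap U

/-- The assumptions on the system and on the (possibly unbounded) observable `χ ≥ 0`: for all
`l > 0` the functions `χ 1_{χ ≤ l}` and `1_{χ > l}` are in `F`, with norms at most `K₁ l`
and `K₂`. -/
structure PropertyD (T : Ω → Ω) (ι : F →ₗ[𝕜] (Ω →ₘ[μ] 𝕜)) (χ : Ω → ℝ) : Prop where
  propertyC : PropertyC T ι
  measurable : Measurable χ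
  nonneg : ∀ ω, 0 ≤ χ ω
  truncation : ∃ K₁ : ℝ, 0 < K₁ ∧ ∀ l : ℝ, 0 < l → ∃ f : F,
    (ι f =ᵐ[μ] fun ω => (({x | χ x ≤ l}.indicator χ ω : ℝ) : 𝕜)) ∧ ‖f‖ ≤ K₁ * l
  exceedance : ∃ K₂ : ℝ, 0 < K₂ ∧ ∀ l : ℝ, 0 < l → ∃ f : F,
    (ι f =ᵐ[μ] {x | l < χ x}.indicator (fun _ => (1 : 𝕜))) ∧ ‖f‖ ≤ K₂

end Systems

/-- The set `Ψ` of positive sequences `(ψ n)`, `n ≥ 1`, with `∑ 1 / ψ n < ∞`. -/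
def PsiClass : Set (ℕ → ℝ) :=
  {ψ | (∀ n, 1 ≤ n → 0 < ψ n) ∧ Summable fun n => 1 / ψ n}

/-- `c_{ε,ψ}(k, n) = max {k, log ψ(⌊log n⌋)} ^ (1/2 + ε) * (log ψ(⌊log n⌋)) ^ (1/2 - ε)`. -/
def cBound (ε : ℝ) (ψ : ℕ → ℝ) (k : ℝ) (n : ℕ) : ℝ :=
  (max k (Real.log (ψ ⌊Real.log n⌋₊))) ^ (1 / 2 + ε) *
    (Real.log (ψ ⌊Real.log n⌋₊)) ^ (1 / 2 - ε)

end TrimmedSums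

end

noncomputable section

namespace TrimmedSums

/-! ### Geometric decay and perturbation of the leading eigenvalue -/

section Operators

variable {𝕜 : Type*} [RCLike 𝕜] {F : Type*}

/-! Write `p = μ(χ > u)` and let `S_n` count the visits to `{χ > u}`. Invariance of `μ` forces the
spectral gap into the form `U x = (∫ x) • 1 + N x` with `N` decaying geometrically
(`PropertyC.exists_decay`). Multiplying by `1 + (e^z - 1) 1_{χ > u} = e^{z 1_{χ > u}}` before
applying `U` gives an operator whose iterates at `1` have the exponential moments of `S_n` as
integrals. `perturbed_mass_le` bounds them by `exp (n p (z + E z²))`, with `E` and the range of `z`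
uniform in `u`, since the exceedance indicators are bounded in `F`. The factor `p` in front of `z²`,
which comes from `|f|_∞ ≤ ‖f‖`, puts deviations at scale `√(p n)` instead of `√n`. Chernoff bounds
follow (`PropertyD.exists_tail_le`).

A union bound over single `n` is too expensive, so Borel–Cantelli is applied to the blocks `⌊log n⌋
= m`, each of which may cost `O(1 / ψ m)`. The levels `u_n` are arbitrary, but `S_n` is monotone in
`n` and antitone in `u`. Hence on a cell where `n` and `p (u_n)` vary by a relative amount `δ`, two
extremal sums control everything (`measure_cell_le`), and `O(δ⁻²)` cells suffice at a given size of
the mean (`measure_level_le`). In `measure_block_le` the means are split dyadically, `Q = 2^i L`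
with `L = log ψ(m)`, and `δ` is chosen so that `δ Q` is the allowed deviation. Then `δ² Q = 2^{2εi}
L`: as `ε > 0`, the Chernoff exponent beats the number of cells, the sum over `i` converges, and a
factor `e^{-L} = 1 / ψ m` remains. -/

theorem exists_norm_pow_le [NormedAddCommGroup F] [NormedSpace 𝕜 F] {A : F →L[𝕜] F} {R : ℝ}
    (h : opSpectralRadius A < ENNReal.ofReal R) :
    ∃ r C : ℝ, 0 < r ∧ r < R ∧ 0 < C ∧ ∀ n : ℕ, ‖A ^ n‖ ≤ C * r ^ n := by
  obtain ⟨s, hs, hsR⟩ := exists_between h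
  have hs0 : 0 < s := bot_le.trans_lt hs
  have hst : s ≠ ∞ := (hsR.trans ENNReal.ofReal_lt_top).ne
  have hr : 0 < s.toReal := ENNReal.toReal_pos hs0.ne' hst
  have hev := eventually_lt_of_limsup_lt hs
  obtain ⟨n₀, hn₀⟩ := eventually_atTop.1 hev
  -- The sum absorbs the finitely many powers not covered by the limsup. It includes `j = n₀`, so
  -- that the remaining exponents are nonzero and the root `1 / n` can be undone.
  refine ⟨s.toReal, 1 + ∑ j ∈ Finset.range (n₀ + 1), ‖A ^ j‖ / s.toReal ^ j, hr, ?_, ?_, ?_⟩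
  · exact (ENNReal.lt_ofReal_iff_toReal_lt hst).1 hsR
  · have : 0 ≤ ∑ j ∈ Finset.range (n₀ + 1), ‖A ^ j‖ / s.toReal ^ j :=
      Finset.sum_nonneg fun j _ => by positivity
    linarith
  · intro n
    have hsum : ∀ j, 0 ≤ ‖A ^ j‖ / s.toReal ^ j := fun j => by positivity
    rcases lt_or_ge n (n₀ + 1) with hn | hn
    · have h1 := Finset.single_le_sum (f := fun j => ‖A ^ j‖ / s.toReal ^ j)
        (fun j _ => hsum j) (Finset.mem_range.2 hn)
      rw [← div_le_iff₀ (by positivity)]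
      linarith
    · have hn1 : (n : ℝ) ≠ 0 := by
        have : n ≠ 0 := by omega
        exact_mod_cast this
      have h1 : (‖A ^ n‖₊ : ℝ≥0∞) ≤ s ^ n := by
        have h2 := ENNReal.rpow_le_rpow (hn₀ n (by omega)).le (Nat.cast_nonneg (α := ℝ) n)
        rwa [← ENNReal.rpow_mul, one_div, inv_mul_cancel₀ hn1, ENNReal.rpow_one,
          ENNReal.rpow_natCast] at h2
      have h3 := ENNReal.toReal_mono (ENNReal.pow_ne_top hst) h1
      rw [ENNReal.toReal_pow] at h3
      have h4 : ‖A ^ n‖ ≤ s.toReal ^ n := by simpa using h3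
      have h5 : 0 ≤ ∑ j ∈ Finset.range (n₀ + 1), ‖A ^ j‖ / s.toReal ^ j :=
        Finset.sum_nonneg fun j _ => hsum j
      have h6 : 0 ≤ s.toReal ^ n := by positivity
      nlinarith

/-- If `U x = I x • 1 + N x` with `N` power-contracting, then the total masses `m n = I (Lⁿ 1)` of
the perturbed operator `L x = U ((1 + a f) x)` grow at most like `(1 + p a + O (p a ^ 2))ⁿ`, where
`p = I f`, uniformly over `f` with `‖f‖ ≤ K`. -/
theorem perturbed_mass_le [NormedCommRing F] [NormedAlgebra 𝕜 F] {U N : F →L[𝕜] F}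
    {I : F →ₗ[𝕜] 𝕜} {ρ C K p a : ℝ} {f : F} {g : ℕ → F} {m : ℕ → ℝ}
    (hU : ∀ x, U x = I x • 1 + N x) (hI1 : I 1 = 1) (hIU : ∀ x, I (U x) = I x) (hN1 : N 1 = 0)
    (hρ0 : 0 < ρ) (hρ1 : ρ < 1) (hC : 0 < C) (hN : ∀ n : ℕ, ‖N ^ n‖ ≤ C * ρ ^ n)
    (hK : 0 < K) (hf : ‖f‖ ≤ K) (hp0 : 0 ≤ p) (hp1 : p ≤ 1) (hIf : I f = p)
    (hIfx : ∀ x, ‖I (f * x)‖ ≤ p * ‖x‖)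
    (hg0 : g 0 = 1) (hg : ∀ n, g (n + 1) = U ((1 + (a : 𝕜) • f) * g n))
    (hm : ∀ n, I (g n) = m n) (hmpos : ∀ n, 0 < m n)
    (ha : 4 * C * K / (1 - ρ) * |a| ≤ 1) (ha' : 4 * |a| ≤ 1 - ρ) (n : ℕ) :
    m n ≤ Real.exp (n * p * (a + 4 * C * K / (1 - ρ) * a ^ 2)) := by
  set D := 4 * C * K / (1 - ρ) with hD
  have hρ : 0 < 1 - ρ := by linarith
  have hD0 : 0 < D := by positivity
  have hDρ : D * (1 - ρ) = 4 * (C * K) := by rw [hD]; field_simp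
  -- The part of `g n` in the kernel of `I`. It is the only part that `N` sees, and it stays of
  -- relative size `O(|a|)`.
  set h : ℕ → F := fun n => g n - (m n : 𝕜) • 1 with hh
  have hgh : ∀ n, g n = (m n : 𝕜) • 1 + h n := fun n => by simp [hh]
  have hfg : ∀ n, f * g n = (m n : 𝕜) • f + f * h n := fun n => by
    rw [hgh n, mul_add, mul_smul_comm, mul_one]
  have hqg : ∀ n, (1 + (a : 𝕜) • f) * g n = g n + (a : 𝕜) • (f * g n) := fun n => by
    rw [add_mul, one_mul, smul_mul_assoc]
  have hmr : ∀ n, (m (n + 1) : 𝕜) = m n + a * (m n * p + I (f * h n)) := fun n => by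
    rw [← hm, hg, hIU, hqg, map_add, map_smul, hfg, map_add, map_smul, hIf, hm]
    simp
  have hhr : ∀ n, h (n + 1) = N (h n) + (a : 𝕜) • N (f * g n) := fun n => by
    have h1 : h (n + 1) = N ((1 + (a : 𝕜) • f) * g n) := by
      have h2 : (m (n + 1) : 𝕜) = I ((1 + (a : 𝕜) • f) * g n) := by rw [← hm, hg, hIU]
      simp only [hh]
      rw [h2, hg, hU, add_sub_cancel_left]
    have h3 : N (g n) = N (h n) := by
      conv_lhs => rw [hgh n]
      rw [map_add, map_smul, hN1, smul_zero, zero_add]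
    rw [h1, hqg, map_add, map_smul, h3]
  -- One step multiplies the mass by `1 + a p`, up to `a I (f h)`. Here `hIfx` supplies the factor
  -- `p` and the size of `h` a second factor `|a|`.
  have hmr' : ∀ n, ‖h n‖ ≤ D * |a| * m n →
      |m (n + 1) - m n * (1 + a * p)| ≤ D * a ^ 2 * p * m n := fun n hn => by
    have h1 : ((m (n + 1) - m n * (1 + a * p) : ℝ) : 𝕜) = a * I (f * h n) := by
      rw [RCLike.ofReal_sub, RCLike.ofReal_mul, RCLike.ofReal_add, RCLike.ofReal_mul,
        RCLike.ofReal_one, hmr]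
      ring
    have h2 : |m (n + 1) - m n * (1 + a * p)| = |a| * ‖I (f * h n)‖ := by
      rw [← RCLike.norm_ofReal (K := 𝕜), h1, norm_mul, RCLike.norm_ofReal]
    rw [h2, ← sq_abs a]
    calc |a| * ‖I (f * h n)‖ ≤ |a| * (p * (D * |a| * m n)) := by
          gcongr
          exact (hIfx _).trans (by gcongr)
      _ = D * |a| ^ 2 * p * m n := by ring
  -- Since `N` need not contract in one step, bounding `h n` alone would lose a factor `C` at each
  -- iteration. Treating all `i` at once amounts to using the adapted norm `sup_i ρ^{-i} ‖N^i x‖`.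
  have key : ∀ n i, ‖(N ^ i) (h n)‖ ≤ ρ ^ i * (D * |a| * m n) := by
    intro n
    induction n with
    | zero =>
      intro i
      have hm0 : (m 0 : 𝕜) = 1 := by rw [← hm, hg0, hI1]
      have : h 0 = 0 := by simp [hh, hg0, hm0]
      have := hmpos 0
      rw [‹h 0 = 0›, map_zero, norm_zero]
      positivity
    | succ n ih =>
      intro i
      have hmn := hmpos n
      have hhn : ‖h n‖ ≤ D * |a| * m n := by simpa using ih 0
      have hhn' : ‖h n‖ ≤ m n := hhn.trans (by nlinarith)
      have hfgn : ‖f * g n‖ ≤ 2 * K * m n := by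
        rw [hfg]
        calc ‖(m n : 𝕜) • f + f * h n‖ ≤ ‖(m n : 𝕜) • f‖ + ‖f * h n‖ := norm_add_le _ _
          _ ≤ m n * K + K * m n := by
            gcongr
            · rw [norm_smul, RCLike.norm_ofReal, abs_of_pos hmn]
              gcongr
            · exact (norm_mul_le _ _).trans (by gcongr)
          _ = 2 * K * m n := by ring
      -- The bound for `h (n + 1)` is relative to `m (n + 1)`, so the mass must not drop too much in
      -- one step.
      have hlow : (1 - 2 * |a|) * m n ≤ m (n + 1) := by
        have h1 := (abs_le.1 (hmr' n hhn)).1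
        have h2 : -|a| ≤ a * p := by
          have h3 : |a * p| ≤ |a| := by
            rw [abs_mul, abs_of_nonneg hp0]
            exact mul_le_of_le_one_right (abs_nonneg a) hp1
          have := neg_abs_le (a * p)
          linarith
        have h4 : D * a ^ 2 * p ≤ |a| := by
          rw [← sq_abs]
          calc D * |a| ^ 2 * p = (D * |a|) * |a| * p := by ring
            _ ≤ 1 * |a| * 1 := by gcongr
            _ = |a| := by ring
        nlinarith
      have e : (N ^ i) (h (n + 1)) = (N ^ (i + 1)) (h n) + (a : 𝕜) • (N ^ (i + 1)) (f * g n) := by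
        rw [hhr, map_add, map_smul, pow_succ]
        rfl
      rw [e]
      calc ‖(N ^ (i + 1)) (h n) + (a : 𝕜) • (N ^ (i + 1)) (f * g n)‖
          ≤ ‖(N ^ (i + 1)) (h n)‖ + ‖(a : 𝕜) • (N ^ (i + 1)) (f * g n)‖ := norm_add_le _ _
        _ ≤ ρ ^ (i + 1) * (D * |a| * m n) + |a| * (C * ρ ^ (i + 1) * (2 * K * m n)) := by
          gcongr
          · exact ih _
          · rw [norm_smul, RCLike.norm_ofReal]
            gcongr
            exact (ContinuousLinearMap.le_opNorm _ _).trans (by gcongr; exact hN _)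
        _ = ρ ^ i * |a| * (ρ * (D + 2 * (C * K)) * m n) := by ring
        _ ≤ ρ ^ i * |a| * (D * m (n + 1)) := by
          refine mul_le_mul_of_nonneg_left ?_ (by positivity)
          -- This fixes `D`: of the gap `D (1 - ρ) = 4 C K`, one half pays for the forcing term and
          -- the other for the loss of mass `2 |a| D`.
          calc ρ * (D + 2 * (C * K)) * m n ≤ D * (1 - 2 * |a|) * m n := by
                refine mul_le_mul_of_nonneg_right ?_ hmn.le
                have : D * (4 * |a|) ≤ D * (1 - ρ) := by gcongr
                have : ρ * (C * K) ≤ C * K := mul_le_of_le_one_left (by positivity) hρ1.le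
                nlinarith
            _ ≤ D * m (n + 1) := by
                rw [mul_assoc]
                gcongr
        _ = ρ ^ i * (D * |a| * m (n + 1)) := by ring
  induction n with
  | zero =>
    have hm0 : (m 0 : 𝕜) = 1 := by rw [← hm, hg0, hI1]
    have : m 0 = 1 := by exact_mod_cast hm0
    simp [this]
  | succ n ih =>
    have hhn : ‖h n‖ ≤ D * |a| * m n := by simpa using key n 0
    have h1 := (abs_le.1 (hmr' n hhn)).2
    have h2 := Real.add_one_le_exp (p * (a + D * a ^ 2))
    calc m (n + 1) ≤ m n * (p * (a + D * a ^ 2) + 1) := by linarith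
      _ ≤ Real.exp (n * p * (a + D * a ^ 2)) * Real.exp (p * (a + D * a ^ 2)) :=
        (mul_le_mul_of_nonneg_left h2 (hmpos n).le).trans (by gcongr)
      _ = Real.exp ((n + 1 : ℕ) * p * (a + D * a ^ 2)) := by
        rw [← Real.exp_add]
        push_cast
        congr 1
        ring

end Operators

/-! ### Identification of the leading part of the transfer operator -/

section Systems

variable {𝕜 : Type*} [RCLike 𝕜] {Ω : Type*} [MeasurableSpace Ω] {μ : Measure Ω}
  {F : Type*} [NormedCommRing F] [NormedAlgebra 𝕜 F] {T : Ω → Ω} {ι : F →ₗ[𝕜] (Ω →ₘ[μ] 𝕜)}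

/-- Serves below to show that vectors and integrals vanish: each is invariant under iteration, or
expanded by it, while obeying a decaying or uniform bound. -/
theorem nonpos_of_le_geometric {r C x : ℝ} (h0 : 0 ≤ r) (h1 : r < 1)
    (h : ∀ n : ℕ, x ≤ C * r ^ n) : x ≤ 0 := by
  have := (tendsto_pow_atTop_nhds_zero_of_lt_one h0 h1).const_mul C
  rw [mul_zero] at this
  exact ge_of_tendsto' this h

theorem PropertyC.memLp (h : PropertyC T ι) (f : F) : MemLp (ι f) ∞ μ :=
  memLp_top_of_bound (ι f).aestronglyMeasurable ‖f‖ (h.ae_norm_le f)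

theorem PropertyC.integrable (h : PropertyC T ι) (f : F) : Integrable (ι f) μ := by
  have := h.isProbabilityMeasure
  exact Integrable.of_bound (ι f).aestronglyMeasurable ‖f‖ (h.ae_norm_le f)

/-- The integral as a linear functional on `F`. -/
def PropertyC.mean (h : PropertyC T ι) : F →ₗ[𝕜] 𝕜 where
  toFun f := ∫ ω, ι f ω ∂μ
  map_add' f g := by
    rw [map_add, integral_congr_ae (AEEqFun.coeFn_add _ _)]
    exact integral_add (h.integrable f) (h.integrable g)
  map_smul' c f := by
    rw [map_smul, integral_congr_ae (AEEqFun.coeFn_smul _ _)]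
    exact integral_smul c _

theorem PropertyC.mean_apply (h : PropertyC T ι) (f : F) : h.mean f = ∫ ω, ι f ω ∂μ := rfl

theorem PropertyC.norm_mean_le (h : PropertyC T ι) (f : F) : ‖h.mean f‖ ≤ ‖f‖ := by
  have := h.isProbabilityMeasure
  rw [h.mean_apply]
  simpa using norm_integral_le_of_norm_le_const (h.ae_norm_le f)

theorem PropertyC.mean_one (h : PropertyC T ι) : h.mean 1 = 1 := by
  have := h.isProbabilityMeasure
  rw [h.mean_apply, h.map_one, integral_congr_ae AEEqFun.coeFn_one]
  simp

theorem IsTransferImage.setIntegral_eq {f g : Ω → 𝕜} (H : IsTransferImage T μ f g)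
    (hT : Measurable T) {s : Set Ω} (hs : MeasurableSet s) :
    ∫ ω in s, g ω ∂μ = ∫ ω in T ⁻¹' s, f ω ∂μ := by
  have key := H.2.2 (s.indicator fun _ => (1 : 𝕜)) ((memLp_top_const (1 : 𝕜)).indicator hs)
  rw [← integral_indicator hs, ← integral_indicator (hT hs)]
  convert key using 2
  · ext ω
    by_cases hω : ω ∈ s <;> simp [hω]
  · ext ω
    by_cases hω : T ω ∈ s <;> simp [hω]

theorem isTransferImage_one [IsProbabilityMeasure μ] (hT : MeasurePreserving T μ μ) :
    IsTransferImage T μ (fun _ => (1 : 𝕜)) (fun _ => (1 : 𝕜)) := by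
  refine ⟨integrable_const _, integrable_const _, fun g hg => ?_⟩
  have h1 := integral_map (f := g) hT.measurable.aemeasurable (by rw [hT.map_eq]; exact hg.1)
  rw [hT.map_eq] at h1
  simpa using h1

/-- On `F` the transfer operator is the integral up to an exponentially decaying remainder. -/
theorem PropertyC.exists_decay (h : PropertyC T ι) :
    ∃ (U N : F →L[𝕜] F) (ρ C : ℝ), (∀ f, IsTransferImage T μ (ι f) (ι (U f))) ∧
      (∀ f, U f = h.mean f • 1 + N f) ∧ N 1 = 0 ∧ 0 < ρ ∧ ρ < 1 ∧ 0 < C ∧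
      ∀ n : ℕ, ‖N ^ n‖ ≤ C * ρ ^ n := by
  have := h.isProbabilityMeasure
  have hT := h.mixing.1
  obtain ⟨U, hU, c, P, N, hUPN, hPP, hrank, hPN, hNP, hrad⟩ := h.transfer
  obtain ⟨r, C, hr0, hrc, hC, hN⟩ := exists_norm_pow_le hrad
  obtain ⟨e, he0, he⟩ := finrank_eq_one_iff'.1 hrank
  have hUx : ∀ x, U x = c • P x + N x := fun x => by rw [hUPN]; rfl
  have hPP' : ∀ x, P (P x) = P x := fun x => congrArg (fun A : F →L[𝕜] F => A x) hPP
  have hPN' : ∀ x, P (N x) = 0 := fun x => congrArg (fun A : F →L[𝕜] F => A x) hPN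
  have hNP' : ∀ x, N (P x) = 0 := fun x => congrArg (fun A : F →L[𝕜] F => A x) hNP
  have hPe : ∀ x, ∃ s : 𝕜, P x = s • (e : F) := fun x => by
    obtain ⟨s, hs⟩ := he ⟨P x, x, rfl⟩
    exact ⟨s, (congrArg Subtype.val hs).symm⟩
  have hUe : U (e : F) = c • (e : F) := by
    obtain ⟨x, hx⟩ := e.2
    have hx' : P x = e := hx
    rw [hUx, ← hx', hPP', hNP', add_zero]
  have he0' : (e : F) ≠ 0 := fun h0 => he0 (Subtype.ext h0)
  have hone : (1 : F) ≠ 0 := fun h0 => he0' (by rw [← mul_one (e : F), h0, mul_zero])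
  -- For the eigenvector `e`, iterated duality gives `c^n ∫_s e = ∫_{T^{-n} s} e`, which is bounded
  -- by `‖e‖`. If `|c| > 1`, all integrals of `e` over sets vanish, so `e = 0`.
  have hc1 : ‖c‖ ≤ 1 := by
    by_contra! hc
    have hstep : ∀ s, MeasurableSet s →
        c * ∫ ω in s, ι (e : F) ω ∂μ = ∫ ω in T ⁻¹' s, ι (e : F) ω ∂μ := fun s hs => by
      rw [← (hU e).setIntegral_eq hT.measurable hs, hUe, map_smul, ← smul_eq_mul,
        ← integral_smul]
      exact (integral_congr_ae (ae_restrict_of_ae (AEEqFun.coeFn_smul c _))).symm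
    have hn : ∀ (n : ℕ) s, MeasurableSet s → ‖c‖ ^ n * ‖∫ ω in s, ι (e : F) ω ∂μ‖ ≤ ‖(e : F)‖ := by
      intro n
      induction n with
      | zero =>
        intro s hs
        rw [pow_zero, one_mul]
        refine (norm_setIntegral_le_of_norm_le_const_ae' (measure_lt_top μ s)
          ((h.ae_norm_le e).mono fun ω hω _ => hω)).trans ?_
        exact mul_le_of_le_one_right (norm_nonneg _) measureReal_le_one
      | succ n ih =>
        intro s hs
        rw [pow_succ, mul_assoc, ← norm_mul, hstep s hs]
        exact ih _ (hT.measurable hs)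
    refine he0' (h.injective ?_)
    rw [map_zero]
    refine AEEqFun.ext ?_
    refine EventuallyEq.trans ?_ AEEqFun.coeFn_zero.symm
    refine (h.integrable e).ae_eq_zero_of_forall_setIntegral_eq_zero fun s hs _ => ?_
    have hc0 : 0 < ‖c‖ := by linarith
    refine norm_le_zero_iff.1 (nonpos_of_le_geometric (C := ‖(e : F)‖)
      (inv_nonneg.2 hc0.le) (inv_lt_one_of_one_lt₀ hc) fun n => ?_)
    have := hn n s hs
    rw [inv_pow, ← div_eq_mul_inv, le_div_iff₀ (by positivity)]
    linarith
  have hr1 : r < 1 := hrc.trans_le hc1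
  have hfix : ∀ x, N x = x → x = 0 := fun x hx => by
    have hn : ∀ n : ℕ, (N ^ n) x = x := by
      intro n
      induction n with
      | zero => rfl
      | succ n ih =>
        rw [pow_succ]
        change (N ^ n) (N x) = x
        rw [hx, ih]
    refine norm_le_zero_iff.1 (nonpos_of_le_geometric (C := C * ‖x‖) hr0.le hr1 fun n => ?_)
    calc ‖x‖ = ‖(N ^ n) x‖ := by rw [hn]
      _ ≤ C * r ^ n * ‖x‖ := (ContinuousLinearMap.le_opNorm _ _).trans (by gcongr; exact hN n)
      _ = C * ‖x‖ * r ^ n := by ring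
  -- The constant function is its own transfer image because `μ` is invariant.
  have hU1 : U 1 = 1 := by
    refine h.injective (AEEqFun.ext ?_)
    have h1 : (ι 1 : Ω → 𝕜) =ᵐ[μ] fun _ => 1 := by
      rw [h.map_one]
      exact AEEqFun.coeFn_one
    refine EventuallyEq.trans ?_ h1.symm
    refine (hU 1).ae_eq ?_
    have h2 := isTransferImage_one (𝕜 := 𝕜) hT
    refine ⟨h.integrable 1, h2.2.1, fun g hg => (h2.2.2 g hg).trans ?_⟩
    refine integral_congr_ae ?_
    filter_upwards [h1] with ω hω
    rw [hω]
  -- Applying `N` to `U 1 = 1` and using `N P = 0` shows that `N 1` is a fixed point of `N`.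
  have hN1 : N 1 = 0 := hfix _ (by
    have h1 := congrArg N hU1
    rwa [hUx, map_add, map_smul, hNP', smul_zero, zero_add] at h1)
  have hcP : c • P 1 = 1 := by
    have := hUx 1
    rwa [hU1, hN1, add_zero, eq_comm] at this
  have hP1 : P 1 = 1 := by
    have h1 := congrArg P hcP
    rw [map_smul, hPP', hcP] at h1
    exact h1.symm
  have hc : c = 1 := by
    rw [hP1] at hcP
    have : (c - 1) • (1 : F) = 0 := by rw [sub_smul, hcP, one_smul, sub_self]
    exact sub_eq_zero.1 ((smul_eq_zero.1 this).resolve_right hone)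
  have hIU : ∀ x, h.mean (U x) = h.mean x := fun x => by
    have := (hU x).setIntegral_eq hT.measurable MeasurableSet.univ
    simpa [h.mean_apply] using this
  -- On the range of `N` the operator `U` acts as `N`, so the integral is constant along the orbit
  -- `N^n (N x)`, which tends to zero.
  have hIN : ∀ x, h.mean (N x) = 0 := fun x => by
    have hn : ∀ n : ℕ, h.mean ((N ^ n) (N x)) = h.mean (N x) := by
      intro n
      induction n generalizing x with
      | zero => rfl
      | succ n ih =>
        rw [pow_succ]
        change h.mean ((N ^ n) (N (N x))) = _
        rw [ih, ← hIU (N x), hUx, hPN', smul_zero, zero_add]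
    refine norm_le_zero_iff.1 (nonpos_of_le_geometric (C := C * ‖N x‖) hr0.le hr1 fun n => ?_)
    calc ‖h.mean (N x)‖ = ‖h.mean ((N ^ n) (N x))‖ := by rw [hn]
      _ ≤ ‖(N ^ n) (N x)‖ := h.norm_mean_le _
      _ ≤ C * r ^ n * ‖N x‖ := (ContinuousLinearMap.le_opNorm _ _).trans (by gcongr; exact hN n)
      _ = C * ‖N x‖ * r ^ n := by ring
  refine ⟨U, N, r, C, hU, fun x => ?_, hN1, hr0, hr1, hC, hN⟩
  obtain ⟨s, hs⟩ := hPe x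
  obtain ⟨t, ht⟩ := hPe 1
  have ht0 : t ≠ 0 := fun h0 => hone (by rw [← hP1, ht, h0, zero_smul])
  have hPx : P x = (s * t⁻¹) • (1 : F) := by
    rw [← hP1, ht, smul_smul, mul_assoc, inv_mul_cancel₀ ht0, mul_one, hs]
  have hmean : h.mean x = s * t⁻¹ := by
    have := hIU x
    rw [hUx, map_add, hIN, hPx, hc, one_smul, map_smul, h.mean_one, add_zero] at this
    simpa using this.symm
  rw [hUx, hc, one_smul, hPx, hmean]

end Systems

/-! ### Exponential moments and Chernoff bounds -/

theorem abs_birkhoffSum_indicator_le {Ω : Type*} (T : Ω → Ω) (s : Set Ω) (n : ℕ) (ω : Ω) :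
    |birkhoffSum T (s.indicator fun _ => (1 : ℝ)) n ω| ≤ n := by
  unfold birkhoffSum
  refine (Finset.abs_sum_le_sum_abs _ _).trans ?_
  refine (Finset.sum_le_card_nsmul _ _ 1 fun k _ => ?_).trans (by simp)
  by_cases h : T^[k] ω ∈ s <;> simp [h]

theorem abs_mul_birkhoffSum_indicator_le {Ω : Type*} (T : Ω → Ω) (s : Set Ω) (z : ℝ) (n : ℕ) (ω : Ω) :
    |z * birkhoffSum T (s.indicator fun _ => (1 : ℝ)) n ω| ≤ |z| * n := by
  rw [abs_mul]
  gcongr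
  exact abs_birkhoffSum_indicator_le T s n ω

section Systems

variable {𝕜 : Type*} [RCLike 𝕜] {Ω : Type*} [MeasurableSpace Ω] {μ : Measure Ω}
  {F : Type*} [NormedCommRing F] [NormedAlgebra 𝕜 F] {T : Ω → Ω} {ι : F →ₗ[𝕜] (Ω →ₘ[μ] 𝕜)}

theorem measurable_birkhoffSum (hT : Measurable T) {φ : Ω → ℝ} (hφ : Measurable φ) (n : ℕ) :
    Measurable (birkhoffSum T φ n) := by
  unfold birkhoffSum
  exact Finset.measurable_sum _ fun k _ => hφ.comp (hT.iterate k)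

theorem integrable_exp_birkhoffSum [IsFiniteMeasure μ] (hT : Measurable T) {s : Set Ω}
    (hs : MeasurableSet s) (z : ℝ) (n : ℕ) :
    Integrable (fun ω => Real.exp (z * birkhoffSum T (s.indicator fun _ => (1 : ℝ)) n ω)) μ := by
  refine Integrable.of_bound (C := Real.exp (|z| * n)) ?_ (ae_of_all _ fun ω => ?_)
  · exact (((measurable_birkhoffSum hT (measurable_const.indicator hs) n).const_mul
      z).exp).aestronglyMeasurable
  · rw [Real.norm_eq_abs, Real.abs_exp, Real.exp_le_exp]
    exact (le_abs_self _).trans (abs_mul_birkhoffSum_indicator_le T s z n ω)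

/-- The transfer operator, perturbed by the exponential of an indicator function, computes the
exponential moments of the Birkhoff sums. -/
theorem mean_iterate_perturbed (h : PropertyC T ι) {U : F →L[𝕜] F}
    (hU : ∀ f, IsTransferImage T μ (ι f) (ι (U f))) {s : Set Ω} (hs : MeasurableSet s) {f : F}
    (hf : ι f =ᵐ[μ] s.indicator fun _ => (1 : 𝕜)) (z : ℝ) (n : ℕ) (x : F) :
    h.mean ((fun y => U ((1 + ((Real.exp z - 1 : ℝ) : 𝕜) • f) * y))^[n] x) =
      ∫ ω, ι x ω * (Real.exp (z * birkhoffSum T (s.indicator fun _ => (1 : ℝ)) n ω) : 𝕜) ∂μ := by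
  have hT := h.mixing.1
  have := h.isProbabilityMeasure
  induction n generalizing x with
  | zero => simp [h.mean_apply]
  | succ n ih =>
    -- The innermost iterate is peeled off: duality composes the remaining weight with `T`, matching
    -- `S_{n+1} = 1_s + S_n ∘ T`.
    rw [Function.iterate_succ_apply, ih]
    have hW : MemLp (fun ω =>
        (Real.exp (z * birkhoffSum T (s.indicator fun _ => (1 : ℝ)) n ω) : 𝕜)) ∞ μ := by
      refine memLp_top_of_bound ?_ (Real.exp (|z| * n)) (ae_of_all _ fun ω => ?_)
      · exact RCLike.continuous_ofReal.comp_aestronglyMeasurable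
          (integrable_exp_birkhoffSum hT.measurable hs z n).1
      · rw [RCLike.norm_ofReal, Real.abs_exp, Real.exp_le_exp]
        exact (le_abs_self _).trans (abs_mul_birkhoffSum_indicator_le T s z n ω)
    rw [(hU _).2.2 _ hW]
    refine integral_congr_ae ?_
    have h1 : (ι 1 : Ω → 𝕜) =ᵐ[μ] fun _ => 1 := by
      rw [h.map_one]
      exact AEEqFun.coeFn_one
    have e1 := AEEqFun.coeFn_mul (ι (1 + ((Real.exp z - 1 : ℝ) : 𝕜) • f)) (ι x)
    have e2 := AEEqFun.coeFn_add (ι 1) (((Real.exp z - 1 : ℝ) : 𝕜) • ι f)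
    have e3 := AEEqFun.coeFn_smul ((Real.exp z - 1 : ℝ) : 𝕜) (ι f)
    rw [← h.map_mul] at e1
    rw [← map_smul, ← map_add] at e2
    rw [← map_smul] at e3
    filter_upwards [h1, e1, e2, e3, hf] with ω h1 e1 e2 e3 hf
    rw [e1, Pi.mul_apply, e2, Pi.add_apply, e3, Pi.smul_apply, h1, hf, birkhoffSum_succ', mul_add,
      Real.exp_add, RCLike.ofReal_mul]
    by_cases hω : ω ∈ s
    · simp [hω]
      ring
    · simp [hω]

/-- Exponential moments of the counting sums, with second order term of order `p z ^ 2`. -/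
theorem PropertyD.exists_expMoment_le {χ : Ω → ℝ} (hD : PropertyD T ι χ) :
    ∃ z₀ E : ℝ, 0 < z₀ ∧ 0 < E ∧ ∀ u : ℝ, 0 < u → ∀ z : ℝ, |z| ≤ z₀ → ∀ n : ℕ,
      ∫ ω, Real.exp (z * birkhoffSum T ({x | u < χ x}.indicator fun _ => (1 : ℝ)) n ω) ∂μ ≤
        Real.exp (n * μ.real {x | u < χ x} * (z + E * z ^ 2)) := by
  have h := hD.propertyC
  have := h.isProbabilityMeasure
  have hT := h.mixing.1
  obtain ⟨K, hK, hexc⟩ := hD.exceedance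
  obtain ⟨U, N, ρ, C, hU, hUN, hN1, hρ0, hρ1, hC, hN⟩ := h.exists_decay
  set D := 4 * C * K / (1 - ρ) with hDdef
  have hρ : 0 < 1 - ρ := by linarith
  have hD0 : 0 < D := by positivity
  -- With `a = e^z - 1` and `|a| ≤ 2 |z|`, the last two entries give the smallness conditions `D |a|
  -- ≤ 1` and `4 |a| ≤ 1 - ρ`. The constant `1 + 4 D` comes from `a ≤ z + z²` and `a² ≤ 4 z²`.
  refine ⟨min (1 / 2) (min (1 / (2 * D)) ((1 - ρ) / 8)), 1 + 4 * D, by positivity, by positivity,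
    fun u hu z hz n => ?_⟩
  have hz1 : |z| ≤ 1 := (hz.trans (min_le_left _ _)).trans (by norm_num)
  have hz2 : |z| ≤ 1 / (2 * D) := hz.trans ((min_le_right _ _).trans (min_le_left _ _))
  have hz3 : |z| ≤ (1 - ρ) / 8 := hz.trans ((min_le_right _ _).trans (min_le_right _ _))
  have hs : MeasurableSet {x | u < χ x} := measurableSet_lt measurable_const hD.measurable
  set s := {x | u < χ x} with hsdef
  obtain ⟨f, hf, hfK⟩ := hexc u hu
  rw [← hsdef] at hf
  set a := Real.exp z - 1 with ha
  have ha2 : |a| ≤ 2 * |z| := Real.abs_exp_sub_one_le hz1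
  have ha3 : a ≤ z + z ^ 2 := by
    have := (abs_le.1 (Real.abs_exp_sub_one_sub_id_le hz1)).2
    linarith
  set m : ℕ → ℝ := fun n => ∫ ω, Real.exp (z * birkhoffSum T (s.indicator fun _ => (1 : ℝ)) n ω) ∂μ
    with hmdef
  have hfmul : ∀ x, h.mean (f * x) = ∫ ω in s, ι x ω ∂μ := fun x => by
    rw [h.mean_apply, ← integral_indicator hs, h.map_mul]
    refine integral_congr_ae ?_
    filter_upwards [AEEqFun.coeFn_mul (ι f) (ι x), hf] with ω h1 h2
    rw [h1, Pi.mul_apply, h2]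
    by_cases hω : ω ∈ s <;> simp [hω]
  have h1 : (ι 1 : Ω → 𝕜) =ᵐ[μ] fun _ => 1 := by
    rw [h.map_one]
    exact AEEqFun.coeFn_one
  have hIf : h.mean f = (μ.real s : 𝕜) := by
    rw [← mul_one f, hfmul, integral_congr_ae (ae_restrict_of_ae h1)]
    simp [RCLike.real_smul_eq_coe_mul]
  have hIU : ∀ x, h.mean (U x) = h.mean x := fun x => by
    have := (hU x).setIntegral_eq hT.measurable MeasurableSet.univ
    simpa [h.mean_apply] using this
  have hmean : ∀ n, h.mean ((fun y => U ((1 + (a : 𝕜) • f) * y))^[n] 1) = m n := fun n => by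
    rw [mean_iterate_perturbed h hU hs hf z n 1, hmdef]
    dsimp only
    rw [← integral_ofReal]
    refine integral_congr_ae ?_
    filter_upwards [h1] with ω hω
    rw [hω, one_mul]
  have hbound := perturbed_mass_le (𝕜 := 𝕜) (f := f) (K := K) (p := μ.real s) (a := a)
    (g := fun n => (fun y => U ((1 + (a : 𝕜) • f) * y))^[n] 1) (m := m)
    hUN h.mean_one hIU hN1 hρ0 hρ1 hC hN hK hfK measureReal_nonneg measureReal_le_one hIf
    -- The integral over `s` is bounded by `μ(s)` times the sup norm; this is where `|x|_∞ ≤ ‖x‖`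
    -- yields the factor `p`.
    (fun x => by
      rw [hfmul, mul_comm]
      exact norm_setIntegral_le_of_norm_le_const_ae' (measure_lt_top μ s)
        ((h.ae_norm_le x).mono fun ω hω _ => hω))
    rfl (fun n => Function.iterate_succ_apply' _ n 1) hmean
    (fun n => integral_exp_pos (integrable_exp_birkhoffSum hT.measurable hs z n))
    (by
      rw [← hDdef]
      calc D * |a| ≤ D * (2 * (1 / (2 * D))) := by gcongr; linarith
        _ = 1 := by field_simp)
    (by linarith) n
  refine hbound.trans (Real.exp_le_exp.2 ?_)
  refine mul_le_mul_of_nonneg_left ?_ (by positivity)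
  have : a ^ 2 ≤ 4 * z ^ 2 := by
    rw [← sq_abs a, ← sq_abs z]
    nlinarith [abs_nonneg a]
  rw [← hDdef]
  nlinarith

/-- Upper and lower Chernoff bounds for the counting sums. -/
theorem PropertyD.exists_tail_le {χ : Ω → ℝ} (hD : PropertyD T ι χ) :
    ∃ z₀ E : ℝ, 0 < z₀ ∧ 0 < E ∧ ∀ u : ℝ, 0 < u → ∀ z : ℝ, 0 ≤ z → z ≤ z₀ → ∀ (n : ℕ) (t : ℝ),
      μ {ω | t ≤ birkhoffSum T ({x | u < χ x}.indicator fun _ => (1 : ℝ)) n ω -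
          μ.real {x | u < χ x} * n} ≤
        ENNReal.ofReal (Real.exp (-(z * t) + E * z ^ 2 * (μ.real {x | u < χ x} * n))) ∧
      μ {ω | t ≤ μ.real {x | u < χ x} * n -
          birkhoffSum T ({x | u < χ x}.indicator fun _ => (1 : ℝ)) n ω} ≤
        ENNReal.ofReal (Real.exp (-(z * t) + E * z ^ 2 * (μ.real {x | u < χ x} * n))) := by
  obtain ⟨z₀, E, hz₀, hE, hexp⟩ := hD.exists_expMoment_le
  have := hD.propertyC.isProbabilityMeasure
  have hT := hD.propertyC.mixing.1.measurable
  refine ⟨z₀, E, hz₀, hE, fun u hu z hz hzz n t => ?_⟩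
  have hs : MeasurableSet {x | u < χ x} := measurableSet_lt measurable_const hD.measurable
  set p := μ.real {x | u < χ x}
  set S := birkhoffSum T ({x | u < χ x}.indicator fun _ => (1 : ℝ)) n with hS
  constructor
  · have h1 := ProbabilityTheory.measure_ge_le_exp_mul_mgf (X := S) (μ := μ) (t + p * n) hz
      (integrable_exp_birkhoffSum hT hs z n)
    rw [← ofReal_measureReal]
    refine ENNReal.ofReal_le_ofReal ?_
    calc μ.real {ω | t ≤ S ω - p * n} = μ.real {ω | t + p * n ≤ S ω} := by
          simp only [le_sub_iff_add_le]
      _ ≤ Real.exp (-z * (t + p * n)) * ProbabilityTheory.mgf S μ z := h1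
      _ ≤ Real.exp (-z * (t + p * n)) * Real.exp (n * p * (z + E * z ^ 2)) := by
        gcongr
        exact hexp u hu z (by rwa [abs_of_nonneg hz]) n
      _ = _ := by
        rw [← Real.exp_add]
        congr 1
        ring
  · have h1 := ProbabilityTheory.measure_le_le_exp_mul_mgf (X := S) (μ := μ) (p * n - t)
      (neg_nonpos.2 hz) (integrable_exp_birkhoffSum hT hs (-z) n)
    rw [← ofReal_measureReal]
    refine ENNReal.ofReal_le_ofReal ?_
    calc μ.real {ω | t ≤ p * n - S ω} = μ.real {ω | S ω ≤ p * n - t} := by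
          simp only [le_sub_comm]
      _ ≤ Real.exp (-(-z) * (p * n - t)) * ProbabilityTheory.mgf S μ (-z) := h1
      _ ≤ Real.exp (-(-z) * (p * n - t)) * Real.exp (n * p * (-z + E * (-z) ^ 2)) := by
        gcongr
        exact hexp u hu (-z) (by rwa [abs_neg, abs_of_nonneg hz]) n
      _ = _ := by
        rw [← Real.exp_add]
        congr 1
        ring

end Systems

/-! ### Maximal deviations over a block of indices -/

section Discretization

/-- The two-sided Chernoff bound `exp (-z t + E z² k)`, with mean `k = p u * n`, for the family
`S n u`. -/
def ChernoffBound {Ω : Type*} [MeasurableSpace Ω] (μ : Measure Ω) (S : ℕ → ℝ → Ω → ℝ) (p : ℝ → ℝ)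
    (z₀ E : ℝ) : Prop :=
  ∀ u : ℝ, 0 < u → ∀ z : ℝ, 0 ≤ z → z ≤ z₀ → ∀ (n : ℕ) (t : ℝ),
    μ {ω | t ≤ S n u ω - p u * n} ≤
      ENNReal.ofReal (Real.exp (-(z * t) + E * z ^ 2 * (p u * n))) ∧
    μ {ω | t ≤ p u * n - S n u ω} ≤
      ENNReal.ofReal (Real.exp (-(z * t) + E * z ^ 2 * (p u * n)))

variable {Ω : Type*} [MeasurableSpace Ω] {μ : Measure Ω} {S : ℕ → ℝ → Ω → ℝ} {p : ℝ → ℝ}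
  {z₀ E : ℝ} {u : ℕ → ℝ}

/-- Over a cell of indices with nearly constant `n` and `p (u n)`, monotonicity reduces the maximal
deviation to one upper and one lower tail. -/
theorem measure_cell_le (htail : ChernoffBound μ S p z₀ E) (hz₀ : 0 < z₀) (hE : 0 < E)
    (hSm : ∀ u ω, Monotone fun n => S n u ω) (hSa : ∀ n ω, Antitone fun u => S n u ω)
    (hp : Antitone p) (hp0 : ∀ u, 0 ≤ p u) (hu : ∀ n, 1 ≤ n → 0 < u n)
    {X Q δ V : ℝ} (hX : 1 ≤ X) (hδ : 0 < δ) (hδ1 : δ ≤ 1) (J : Finset ℕ)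
    (hJX : ∀ n ∈ J, X ≤ n) (hJX' : ∀ n ∈ J, (n : ℝ) ≤ 3 * X)
    (hJQ : ∀ n ∈ J, p (u n) * n ≤ 2 * Q)
    (hJn : ∀ n ∈ J, ∀ n' ∈ J, (n : ℝ) - n' ≤ δ * X)
    (hJp : ∀ n ∈ J, ∀ n' ∈ J, (p (u n) - p (u n')) * X ≤ δ * Q) :
    μ {ω | ∃ n ∈ J, V * (δ * Q) ≤ |S n (u n) ω - p (u n) * n|} ≤
      ENNReal.ofReal (2 * Real.exp (-((z₀ * (V - 5) - 6 * E * z₀ ^ 2) * (δ ^ 2 * Q)))) := by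
  rcases J.eq_empty_or_nonempty with rfl | hJ
  · simp
  have hX0 : 0 < X := by linarith
  have hpos : ∀ n ∈ J, 0 < u n := fun n hn => hu n (by
    have := hX.trans (hJX n hn)
    exact_mod_cast this)
  -- The extremes of `n` and of `u` are taken separately, so the corners `(a, u b)` and `(a', u b')`
  -- need not be pairs `(n, u n)`. No monotonicity of `u` is needed.
  obtain ⟨a, ha, hamax⟩ := J.exists_max_image id hJ
  obtain ⟨a', ha', hamin⟩ := J.exists_min_image id hJ
  obtain ⟨b, hb, hbmin⟩ := J.exists_min_image u hJ
  obtain ⟨b', hb', hbmax⟩ := J.exists_max_image u hJ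
  have hpX : ∀ n ∈ J, p (u n) * X ≤ 2 * Q := fun n hn =>
    (mul_le_mul_of_nonneg_left (hJX n hn) (hp0 _)).trans (hJQ n hn)
  -- Between corner and cell member the mean changes by at most `2 δ Q` through `n` and `3 δ Q`
  -- through `p`, hence the loss `V - 5` in the threshold.
  have hvar : ∀ n ∈ J, ∀ n' ∈ J, ∀ k ∈ J, ∀ k' ∈ J, k ≤ n → p (u k') ≤ p (u n') →
      p (u n') * n - p (u k') * k ≤ 5 * (δ * Q) := fun n hn n' hn' k hk k' hk' hkn hpk => by
    have h1 : p (u n') * ((n : ℝ) - k) ≤ p (u n') * (δ * X) :=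
      mul_le_mul_of_nonneg_left (hJn n hn k hk) (hp0 _)
    have h2 : p (u n') * (δ * X) ≤ 2 * (δ * Q) := by
      have := mul_le_mul_of_nonneg_left (hpX n' hn') hδ.le
      linarith
    have h3 : (p (u n') - p (u k')) * k ≤ (p (u n') - p (u k')) * (3 * X) :=
      mul_le_mul_of_nonneg_left (hJX' k hk) (sub_nonneg.2 hpk)
    have h4 := hJp n' hn' k' hk'
    linarith
  have hmean : ∀ n ∈ J, ∀ n' ∈ J, p (u n') * n ≤ 6 * Q := fun n hn n' hn' => by
    have h1 := mul_le_mul_of_nonneg_left (hJX' n hn) (hp0 (u n'))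
    have h2 := hpX n' hn'
    linarith
  have hexp : ∀ n ∈ J, ∀ n' ∈ J,
      ENNReal.ofReal (Real.exp (-(z₀ * δ * ((V - 5) * (δ * Q))) +
        E * (z₀ * δ) ^ 2 * (p (u n') * n))) ≤
      ENNReal.ofReal (Real.exp (-((z₀ * (V - 5) - 6 * E * z₀ ^ 2) * (δ ^ 2 * Q)))) :=
    fun n hn n' hn' => by
    refine ENNReal.ofReal_le_ofReal (Real.exp_le_exp.2 ?_)
    have := mul_le_mul_of_nonneg_left (hmean n hn n' hn')
      (by positivity : 0 ≤ E * (z₀ * δ) ^ 2)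
    linarith
  have hz : z₀ * δ ≤ z₀ := mul_le_of_le_one_right hz₀.le hδ1
  -- Taking `z = z₀ δ`, proportional to the relative deviation, makes both terms of the Chernoff
  -- exponent multiples of `δ² Q`.
  have hup := ((htail (u b) (hpos b hb) (z₀ * δ) (by positivity) hz a
    ((V - 5) * (δ * Q))).1).trans (hexp a ha b hb)
  have hlo := ((htail (u b') (hpos b' hb') (z₀ * δ) (by positivity) hz a'
    ((V - 5) * (δ * Q))).2).trans (hexp a' ha' b' hb')
  rw [two_mul, ENNReal.ofReal_add (Real.exp_nonneg _) (Real.exp_nonneg _)]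
  refine (measure_mono ?_).trans ((measure_union_le _ _).trans (add_le_add hup hlo))
  rintro ω ⟨n, hn, hω⟩
  rcases le_abs.1 hω with h | h
  · left
    have h1 : S n (u n) ω ≤ S a (u b) ω :=
      (hSm (u n) ω (hamax n hn)).trans (hSa a ω (hbmin n hn))
    have h2 := hvar a ha b hb n hn n hn (hamax n hn) (hp (hbmin n hn))
    change (V - 5) * (δ * Q) ≤ S a (u b) ω - p (u b) * a
    linarith
  · right
    have h1 : S a' (u b') ω ≤ S n (u n) ω :=
      (hSm (u b') ω (hamin n hn)).trans (hSa n ω (hbmax n hn))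
    have h2 := hvar n hn n hn a' ha' b' hb' (hamin n hn) (hp (hbmax n hn))
    change (V - 5) * (δ * Q) ≤ p (u b') * a' - S a' (u b') ω
    linarith

theorem sub_le_of_floor_div_eq {x y d : ℝ} (hd : 0 < d) (hy : 0 ≤ y)
    (h : ⌊x / d⌋₊ = ⌊y / d⌋₊) : x - y ≤ d := by
  have h1 := Nat.lt_floor_add_one (x / d)
  have h2 := Nat.floor_le (div_nonneg hy hd.le)
  rw [h] at h1
  rw [div_lt_iff₀ hd] at h1
  rw [le_div_iff₀ hd] at h2
  nlinarith

/-- The maximal deviation over the indices `n ∈ [X, 3 X]` with mean at most `2 Q`. -/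
theorem measure_level_le (htail : ChernoffBound μ S p z₀ E) (hz₀ : 0 < z₀) (hE : 0 < E)
    (hSm : ∀ u ω, Monotone fun n => S n u ω) (hSa : ∀ n ω, Antitone fun u => S n u ω)
    (hp : Antitone p) (hp0 : ∀ u, 0 ≤ p u) (hu : ∀ n, 1 ≤ n → 0 < u n)
    {X Q δ V : ℝ} (hX : 1 ≤ X) (hQ : 0 < Q) (hδ : 0 < δ) (hδ1 : δ ≤ 1) :
    μ {ω | ∃ n : ℕ, X ≤ n ∧ (n : ℝ) ≤ 3 * X ∧ p (u n) * n ≤ 2 * Q ∧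
        V * (δ * Q) ≤ |S n (u n) ω - p (u n) * n|} ≤
      ENNReal.ofReal
        (24 / δ ^ 2 * Real.exp (-((z₀ * (V - 5) - 6 * E * z₀ ^ 2) * (δ ^ 2 * Q)))) := by
  classical
  have hX0 : 0 < X := by linarith
  set e := Real.exp (-((z₀ * (V - 5) - 6 * E * z₀ ^ 2) * (δ ^ 2 * Q))) with he
  -- From `n ≤ 3 X` and `p X ≤ p n ≤ 2 Q`, the labels are at most `3 / δ` and `2 / δ`.
  set I := Finset.range (⌊3 / δ⌋₊ + 1) ×ˢ Finset.range (⌊2 / δ⌋₊ + 1) with hI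
  set J : ℕ × ℕ → Finset ℕ := fun c => (Finset.range (⌊3 * X⌋₊ + 1)).filter fun n =>
    (X ≤ n ∧ (n : ℝ) ≤ 3 * X ∧ p (u n) * n ≤ 2 * Q) ∧
      ⌊(n : ℝ) / (δ * X)⌋₊ = c.1 ∧ ⌊p (u n) * X / (δ * Q)⌋₊ = c.2 with hJ
  have hcell : ∀ c, μ {ω | ∃ n ∈ J c, V * (δ * Q) ≤ |S n (u n) ω - p (u n) * n|} ≤
      ENNReal.ofReal (2 * e) := fun c => by
    have hmem : ∀ n ∈ J c, (X ≤ n ∧ (n : ℝ) ≤ 3 * X ∧ p (u n) * n ≤ 2 * Q) ∧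
        ⌊(n : ℝ) / (δ * X)⌋₊ = c.1 ∧ ⌊p (u n) * X / (δ * Q)⌋₊ = c.2 := fun n hn =>
      (Finset.mem_filter.1 hn).2
    refine measure_cell_le htail hz₀ hE hSm hSa hp hp0 hu hX hδ hδ1 (J c)
      (fun n hn => (hmem n hn).1.1) (fun n hn => (hmem n hn).1.2.1)
      (fun n hn => (hmem n hn).1.2.2) (fun n hn n' hn' => ?_) (fun n hn n' hn' => ?_)
    · exact sub_le_of_floor_div_eq (by positivity) (Nat.cast_nonneg _)
        ((hmem n hn).2.1.trans (hmem n' hn').2.1.symm)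
    · rw [sub_mul]
      exact sub_le_of_floor_div_eq (by positivity) (mul_nonneg (hp0 _) hX0.le)
        ((hmem n hn).2.2.trans (hmem n' hn').2.2.symm)
  have hcover : {ω | ∃ n : ℕ, X ≤ n ∧ (n : ℝ) ≤ 3 * X ∧ p (u n) * n ≤ 2 * Q ∧
        V * (δ * Q) ≤ |S n (u n) ω - p (u n) * n|} ⊆
      ⋃ c ∈ I, {ω | ∃ n ∈ J c, V * (δ * Q) ≤ |S n (u n) ω - p (u n) * n|} := by
    rintro ω ⟨n, h1, h2, h3, h4⟩
    refine Set.mem_biUnion (x := (⌊(n : ℝ) / (δ * X)⌋₊, ⌊p (u n) * X / (δ * Q)⌋₊)) ?_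
      ⟨n, ?_, h4⟩
    · simp only [hI, SetLike.mem_coe, Finset.mem_product, Finset.mem_range, Nat.lt_succ_iff]
      refine ⟨Nat.floor_le_floor ?_, Nat.floor_le_floor ?_⟩
      · rw [div_le_div_iff₀ (by positivity) hδ]
        nlinarith
      · rw [div_le_div_iff₀ (by positivity) hδ]
        have := mul_le_mul_of_nonneg_left h1 (hp0 (u n))
        nlinarith
    · simp only [hJ, Finset.mem_filter, Finset.mem_range, Nat.lt_succ_iff, and_true]
      exact ⟨Nat.le_floor h2, h1, h2, h3⟩
  have hcard : ((I.card : ℕ) : ℝ) ≤ 12 / δ ^ 2 := by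
    have h1 : 1 ≤ 1 / δ := (one_le_div hδ).2 hδ1
    have h2 : ((⌊3 / δ⌋₊ + 1 : ℕ) : ℝ) ≤ 4 * (1 / δ) := by
      have := Nat.floor_le (by positivity : 0 ≤ 3 / δ)
      push_cast
      have : 3 / δ = 3 * (1 / δ) := by ring
      linarith
    have h3 : ((⌊2 / δ⌋₊ + 1 : ℕ) : ℝ) ≤ 3 * (1 / δ) := by
      have := Nat.floor_le (by positivity : 0 ≤ 2 / δ)
      push_cast
      have : 2 / δ = 2 * (1 / δ) := by ring
      linarith
    rw [hI, Finset.card_product, Finset.card_range, Finset.card_range, Nat.cast_mul]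
    calc _ ≤ (4 * (1 / δ)) * (3 * (1 / δ)) := by gcongr
      _ = 12 / δ ^ 2 := by field_simp; norm_num
  calc _ ≤ μ (⋃ c ∈ I, {ω | ∃ n ∈ J c, V * (δ * Q) ≤ |S n (u n) ω - p (u n) * n|}) :=
        measure_mono hcover
    _ ≤ ∑ c ∈ I, μ {ω | ∃ n ∈ J c, V * (δ * Q) ≤ |S n (u n) ω - p (u n) * n|} :=
        measure_biUnion_finset_le _ _
    _ ≤ ∑ _c ∈ I, ENNReal.ofReal (2 * e) := Finset.sum_le_sum fun c _ => hcell c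
    _ = ENNReal.ofReal (I.card * (2 * e)) := by
        rw [Finset.sum_const, nsmul_eq_mul, ENNReal.ofReal_mul (Nat.cast_nonneg _),
          ENNReal.ofReal_natCast]
    _ ≤ ENNReal.ofReal (24 / δ ^ 2 * e) := by
        refine ENNReal.ofReal_le_ofReal ?_
        have := mul_le_mul_of_nonneg_right hcard (by positivity : 0 ≤ 2 * e)
        calc _ ≤ 12 / δ ^ 2 * (2 * e) := this
          _ = 24 / δ ^ 2 * e := by ring

/-- For `k` with `y^k > 4`, the `k`-th term of the exponential series gives `exp (y^i) ≥ 4^i / k!`,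
so the terms are dominated by `k! 2^{-i}`. -/
theorem summable_two_pow_mul_exp {y : ℝ} (hy : 1 < y) :
    Summable fun i : ℕ => (2 : ℝ) ^ i * Real.exp (-y ^ i) := by
  obtain ⟨k, hk⟩ := pow_unbounded_of_one_lt 4 hy
  have hg := (summable_geometric_of_lt_one (by norm_num : (0 : ℝ) ≤ 1 / 2)
    (by norm_num)).mul_left (k.factorial : ℝ)
  refine Summable.of_nonneg_of_le (fun i => by positivity) (fun i => ?_) hg
  have hy0 : 0 < y := by linarith
  have h1 := Real.pow_div_factorial_le_exp (y ^ i) (by positivity) k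
  have h2 : (4 : ℝ) ^ i ≤ (y ^ i) ^ k := by
    rw [← pow_mul, mul_comm, pow_mul]
    gcongr
  have hk0 : (0 : ℝ) < k.factorial := by exact_mod_cast k.factorial_pos
  have h3 : (4 : ℝ) ^ i ≤ k.factorial * Real.exp (y ^ i) := by
    rw [div_le_iff₀ hk0] at h1
    linarith
  rw [Real.exp_neg, ← div_eq_mul_inv, div_le_iff₀ (Real.exp_pos _)]
  have h4 : (4 : ℝ) ^ i = 2 ^ i * 2 ^ i := by rw [← mul_pow]; norm_num
  have h5 : (1 / 2 : ℝ) ^ i * 2 ^ i = 1 := by rw [← mul_pow]; norm_num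
  calc (2 : ℝ) ^ i = (1 / 2) ^ i * 4 ^ i := by rw [h4, ← mul_assoc, h5, one_mul]
    _ ≤ (1 / 2) ^ i * (k.factorial * Real.exp (y ^ i)) := by gcongr
    _ = _ := by ring

/-- The maximal deviation over `n ∈ [X, 3 X]`, weighted by the mean. -/
theorem measure_block_le (htail : ChernoffBound μ S p z₀ E) (hz₀ : 0 < z₀) (hE : 0 < E)
    (hSm : ∀ u ω, Monotone fun n => S n u ω) (hSa : ∀ n ω, Antitone fun u => S n u ω)
    (hp : Antitone p) (hp0 : ∀ u, 0 ≤ p u) (hu : ∀ n, 1 ≤ n → 0 < u n)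
    {X L V ε : ℝ} (hX : 1 ≤ X) (hL : 1 ≤ L) (hV0 : 0 < V)
    (hV : 2 ≤ z₀ * (V - 5) - 6 * E * z₀ ^ 2) (hε0 : 0 < ε) (hε : ε < 1 / 4) :
    μ {ω | ∃ n : ℕ, X ≤ n ∧ (n : ℝ) ≤ 3 * X ∧
        V * (max (p (u n) * n) L ^ (1 / 2 + ε) * L ^ (1 / 2 - ε)) ≤
          |S n (u n) ω - p (u n) * n|} ≤
      ENNReal.ofReal (Real.exp (-L)) *
        ENNReal.ofReal (24 * ∑' i : ℕ, (2 : ℝ) ^ i * Real.exp (-((2 : ℝ) ^ (2 * ε)) ^ i)) := by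
  have hL0 : 0 < L := by linarith
  have h2 : (0 : ℝ) ≤ 2 := by norm_num
  set y : ℝ := (2 : ℝ) ^ (2 * ε) with hy
  have hy1 : 1 < y := Real.one_lt_rpow (by norm_num) (by linarith)
  -- Chosen so that with `δ = d^i` and `Q = 2^i L` the deviation `δ Q` equals `Q^{1/2+ε} L^{1/2-ε}`,
  -- while `δ² Q = y^i L` still grows in `i`.
  set d : ℝ := (2 : ℝ) ^ (-(1 / 2 - ε)) with hd
  have hd0 : 0 < d := by positivity
  have hd1 : d ≤ 1 := Real.rpow_le_one_of_one_le_of_nonpos (by norm_num) (by linarith)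
  have hd2 : d ^ 2 * 2 = y := by
    rw [hd, hy, ← Real.rpow_natCast, ← Real.rpow_mul h2]
    rw [← Real.rpow_add_one (by norm_num)]
    congr 1
    push_cast
    ring
  have hd3 : d * 2 = (2 : ℝ) ^ (1 / 2 + ε) := by
    rw [hd]
    rw [← Real.rpow_add_one (by norm_num)]
    congr 1
    ring
  have hsum := (summable_two_pow_mul_exp hy1).mul_left 24
  have hlevel : ∀ i : ℕ, μ {ω | ∃ n : ℕ, X ≤ n ∧ (n : ℝ) ≤ 3 * X ∧
        p (u n) * n ≤ 2 * (2 ^ i * L) ∧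
        V * (d ^ i * (2 ^ i * L)) ≤ |S n (u n) ω - p (u n) * n|} ≤
      ENNReal.ofReal (Real.exp (-L)) *
        ENNReal.ofReal (24 * ((2 : ℝ) ^ i * Real.exp (-y ^ i))) := fun i => by
    refine (measure_level_le htail hz₀ hE hSm hSa hp hp0 hu hX (by positivity)
      (by positivity) (pow_le_one₀ hd0.le hd1)).trans ?_
    rw [← ENNReal.ofReal_mul (Real.exp_nonneg _)]
    refine ENNReal.ofReal_le_ofReal ?_
    have e1 : (d ^ i) ^ 2 * (2 ^ i * L) = y ^ i * L := by
      rw [← hd2, mul_pow, ← pow_mul, ← pow_mul, mul_comm 2 i, mul_assoc]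
    have hyi : 1 ≤ y ^ i := one_le_pow₀ hy1.le
    have h3 : 24 / (d ^ i) ^ 2 ≤ 24 * 2 ^ i := by
      rw [div_le_iff₀ (by positivity)]
      have : (d ^ i) ^ 2 * 2 ^ i = y ^ i := by
        rw [← hd2, mul_pow, ← pow_mul, ← pow_mul, mul_comm 2 i]
      nlinarith
    -- Since `L` and `y^i` are both at least `1`, `2 y^i L ≥ L + y^i`. This splits off `exp (-L)`
    -- and leaves a series in `i` that does not depend on `L`.
    have h4 : Real.exp (-((z₀ * (V - 5) - 6 * E * z₀ ^ 2) * ((d ^ i) ^ 2 * (2 ^ i * L)))) ≤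
        Real.exp (-L) * Real.exp (-y ^ i) := by
      rw [← Real.exp_add, Real.exp_le_exp, e1]
      have h5 : 2 * (y ^ i * L) ≤ (z₀ * (V - 5) - 6 * E * z₀ ^ 2) * (y ^ i * L) := by gcongr
      nlinarith
    calc _ ≤ 24 * 2 ^ i * (Real.exp (-L) * Real.exp (-y ^ i)) := by gcongr
      _ = _ := by ring
  have hcover : {ω | ∃ n : ℕ, X ≤ n ∧ (n : ℝ) ≤ 3 * X ∧
        V * (max (p (u n) * n) L ^ (1 / 2 + ε) * L ^ (1 / 2 - ε)) ≤
          |S n (u n) ω - p (u n) * n|} ⊆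
      ⋃ i : ℕ, {ω | ∃ n : ℕ, X ≤ n ∧ (n : ℝ) ≤ 3 * X ∧ p (u n) * n ≤ 2 * (2 ^ i * L) ∧
        V * (d ^ i * (2 ^ i * L)) ≤ |S n (u n) ω - p (u n) * n|} := by
    rintro ω ⟨n, h3, h4, h5⟩
    obtain ⟨i, hi1, hi2⟩ := exists_nat_pow_near (x := max (p (u n) * n) L / L) (y := 2)
      ((one_le_div hL0).2 (le_max_right _ _)) (by norm_num)
    rw [le_div_iff₀ hL0] at hi1
    rw [div_lt_iff₀ hL0] at hi2
    refine Set.mem_iUnion.2 ⟨i, n, h3, h4, ?_, le_trans ?_ h5⟩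
    · refine ((le_max_left _ _).trans hi2.le).trans_eq ?_
      ring
    · refine mul_le_mul_of_nonneg_left ?_ hV0.le
      calc d ^ i * (2 ^ i * L) = (2 ^ i * L) ^ (1 / 2 + ε) * L ^ (1 / 2 - ε) := by
            rw [Real.mul_rpow (by positivity) hL0.le, mul_assoc, ← Real.rpow_add hL0,
              ← Real.rpow_natCast 2 i, ← Real.rpow_mul h2, mul_comm (i : ℝ), Real.rpow_mul h2,
              ← hd3, Real.rpow_natCast, Real.rpow_natCast, mul_pow, ← mul_assoc]
            norm_num
        _ ≤ _ := by gcongr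
  calc _ ≤ μ (⋃ i : ℕ, {ω | ∃ n : ℕ, X ≤ n ∧ (n : ℝ) ≤ 3 * X ∧ p (u n) * n ≤ 2 * (2 ^ i * L) ∧
        V * (d ^ i * (2 ^ i * L)) ≤ |S n (u n) ω - p (u n) * n|}) := measure_mono hcover
    _ ≤ ∑' i : ℕ, μ {ω | ∃ n : ℕ, X ≤ n ∧ (n : ℝ) ≤ 3 * X ∧ p (u n) * n ≤ 2 * (2 ^ i * L) ∧
        V * (d ^ i * (2 ^ i * L)) ≤ |S n (u n) ω - p (u n) * n|} := measure_iUnion_le _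
    _ ≤ ∑' i : ℕ, ENNReal.ofReal (Real.exp (-L)) *
        ENNReal.ofReal (24 * ((2 : ℝ) ^ i * Real.exp (-y ^ i))) := ENNReal.tsum_le_tsum hlevel
    _ = _ := by
      rw [ENNReal.tsum_mul_left, ← tsum_mul_left,
        ENNReal.ofReal_tsum_of_nonneg (fun i => by positivity) hsum]

end Discretization

/-! ### Blocks of constant `⌊log n⌋` and Borel–Cantelli -/

theorem monotone_birkhoffSum_of_nonneg {Ω : Type*} (T : Ω → Ω) {φ : Ω → ℝ} (hφ : ∀ ω, 0 ≤ φ ω)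
    (ω : Ω) : Monotone fun n => birkhoffSum T φ n ω := by
  refine monotone_nat_of_le_succ fun n => ?_
  rw [birkhoffSum_succ]
  linarith [hφ (T^[n] ω)]

theorem birkhoffSum_le_birkhoffSum {Ω : Type*} (T : Ω → Ω) {φ φ' : Ω → ℝ} (h : ∀ ω, φ ω ≤ φ' ω)
    (n : ℕ) (ω : Ω) : birkhoffSum T φ n ω ≤ birkhoffSum T φ' n ω :=
  Finset.sum_le_sum fun _ _ => h _

theorem exp_le_and_le_of_floor_log_eq {n m : ℕ} (hm : 1 ≤ m) (h : ⌊Real.log n⌋₊ = m) :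
    Real.exp m ≤ n ∧ (n : ℝ) ≤ 3 * Real.exp m := by
  have hn : n ≠ 0 := by
    rintro rfl
    simp at h
    omega
  have hn0 : (0 : ℝ) < n := by exact_mod_cast Nat.pos_of_ne_zero hn
  have h1 := Nat.floor_le (Real.log_natCast_nonneg n)
  have h2 := Nat.lt_floor_add_one (Real.log n)
  rw [h] at h1 h2
  refine ⟨(Real.le_log_iff_exp_le hn0).1 h1, ?_⟩
  have h3 := (Real.log_lt_iff_lt_exp hn0).1 h2
  rw [Real.exp_add] at h3
  have := Real.exp_one_lt_d9
  nlinarith [Real.exp_pos m]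

theorem eventually_one_le_log_of_mem_psiClass {ψ : ℕ → ℝ} (hψ : ψ ∈ PsiClass) :
    ∀ᶠ m in atTop, 1 ≤ m ∧ 1 ≤ Real.log (ψ m) := by
  have h := (hψ.2.tendsto_atTop_zero).eventually (gt_mem_nhds (Real.exp_pos (-1)))
  filter_upwards [h, eventually_ge_atTop 1] with m hm hm1
  have hpos := hψ.1 m hm1
  refine ⟨hm1, (Real.le_log_iff_exp_le hpos).2 ?_⟩
  rw [Real.exp_neg, ← one_div, one_div_lt_one_div hpos (Real.exp_pos 1)] at hm
  exact hm.le

end TrimmedSums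
end

open TrimmedSums in
theorem lemma2p5 {𝕜 : Type*} [RCLike 𝕜] {Ω : Type*} [MeasurableSpace Ω] {μ : Measure Ω}
    {F : Type*} [NormedCommRing F] [NormedAlgebra 𝕜 F]
    (T : Ω → Ω) (ι : F →ₗ[𝕜] (Ω →ₘ[μ] 𝕜)) (χ : Ω → ℝ) (hD : PropertyD T ι χ) :
    ∃ (N : ℕ) (V : ℝ), 0 < N ∧ 0 < V ∧
      ∀ ε : ℝ, 0 < ε → ε < 1 / 4 → ∀ ψ ∈ PsiClass, ∀ u : ℕ → ℝ, (∀ n, 1 ≤ n → 0 < u n) →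
        μ {ω | ∃ᶠ n : ℕ in atTop, N < n ∧
            V * cBound ε ψ (μ.real {x | u n < χ x} * n) n ≤
              |birkhoffSum T ({x | u n < χ x}.indicator (fun _ => (1 : ℝ))) n ω
                - μ.real {x | u n < χ x} * n|} = 0 := by
  obtain ⟨z₀, E, hz₀, hE, htail⟩ := hD.exists_tail_le
  have := hD.propertyC.isProbabilityMeasure
  set p : ℝ → ℝ := fun u => μ.real {x | u < χ x} with hpdef
  set S : ℕ → ℝ → Ω → ℝ := fun n u =>
    birkhoffSum T ({x | u < χ x}.indicator fun _ => (1 : ℝ)) n with hSdef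
  have hp : Antitone p := fun a b hab =>
    measureReal_mono fun x (hx : b < χ x) => hab.trans_lt hx
  have hp0 : ∀ u, 0 ≤ p u := fun u => measureReal_nonneg
  have hSm : ∀ u ω, Monotone fun n => S n u ω := fun u ω =>
    monotone_birkhoffSum_of_nonneg T (fun x => Set.indicator_nonneg (fun _ _ => zero_le_one) x) ω
  have hSa : ∀ n ω, Antitone fun u => S n u ω := fun n ω a b hab =>
    birkhoffSum_le_birkhoffSum T (fun x => Set.indicator_le_indicator_of_subset
      (fun x (hx : b < χ x) => hab.trans_lt hx) (fun _ => zero_le_one) x) n ω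
  -- `V` is the solution of equality in the condition on `V` of `measure_block_le`. It involves only
  -- `z₀` and `E`, hence neither `ε` nor `ψ`; the dependence on `ε` goes into the factor `B`, which
  -- only has to be finite.
  have hV : 2 ≤ z₀ * (5 + 6 * E * z₀ + 2 / z₀ - 5) - 6 * E * z₀ ^ 2 := by
    refine le_of_eq ?_
    field_simp
    ring
  set V : ℝ := 5 + 6 * E * z₀ + 2 / z₀ with hVdef
  have hV0 : 0 < V := by positivity
  -- Any positive `N` would do, because the event concerns infinitely many `n`.
  refine ⟨1, V, one_pos, hV0, fun ε hε0 hε ψ hψ u hu => ?_⟩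
  obtain ⟨m₀, hm₀⟩ := eventually_atTop.1 (eventually_one_le_log_of_mem_psiClass hψ)
  set L : ℕ → ℝ := fun m => Real.log (ψ m) with hL
  set bad : ℕ → Ω → Prop := fun m ω => m₀ ≤ m ∧ ∃ n : ℕ, ⌊Real.log n⌋₊ = m ∧
    V * cBound ε ψ (p (u n) * n) n ≤ |S n (u n) ω - p (u n) * n| with hbad
  set B := ENNReal.ofReal (24 * ∑' i : ℕ, (2 : ℝ) ^ i * Real.exp (-((2 : ℝ) ^ (2 * ε)) ^ i))
  -- The norm is there because the sign of `ψ 0` is unspecified.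
  have hblock : ∀ m, μ {ω | bad m ω} ≤ ENNReal.ofReal ‖1 / ψ m‖ * B := fun m => by
    by_cases hm : m₀ ≤ m
    · obtain ⟨hm1, hLm⟩ := hm₀ m hm
      have hψm := hψ.1 m hm1
      have h1 := measure_block_le (X := Real.exp m) (L := L m) htail hz₀ hE hSm hSa hp hp0 hu
        (Real.one_le_exp (Nat.cast_nonneg m)) hLm hV0 hV hε0 hε
      rw [Real.exp_neg, Real.exp_log hψm, ← one_div] at h1
      rw [Real.norm_of_nonneg (by positivity)]
      refine (measure_mono ?_).trans h1
      rintro ω ⟨-, n, hn, h2⟩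
      obtain ⟨h3, h4⟩ := exp_le_and_le_of_floor_log_eq hm1 hn
      refine ⟨n, h3, h4, ?_⟩
      unfold cBound at h2
      rwa [hn] at h2
    · simp [hbad, hm]
  have hfin : ∑' m, μ {ω | bad m ω} ≠ ∞ := by
    refine ne_top_of_le_ne_top ?_ (ENNReal.tsum_le_tsum hblock)
    rw [ENNReal.tsum_mul_right]
    exact ENNReal.mul_ne_top
      (ENNReal.ofReal_tsum_of_nonneg (fun m => norm_nonneg _) hψ.2.norm ▸ ENNReal.ofReal_ne_top)
      ENNReal.ofReal_ne_top
  refine measure_mono_null ?_ (measure_setOfPred_frequently_eq_zero hfin)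
  intro ω hω
  -- Since `⌊log n⌋` tends to infinity, bad indices `n` occurring infinitely often lie in infinitely
  -- many blocks.
  have hlog : Tendsto (fun n : ℕ => ⌊Real.log n⌋₊) atTop atTop :=
    tendsto_nat_floor_atTop.comp (Real.tendsto_log_atTop.comp tendsto_natCast_atTop_atTop)
  refine hlog.frequently ?_
  exact (Frequently.and_eventually hω (hlog.eventually (eventually_ge_atTop m₀))).mono
    fun n hn => ⟨hn.2, n, rfl, hn.1.2⟩
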